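/- **Setting.** Let $\boldsymbol\tau=(\tau_n:\mathcal A_{n+1}^*\to\mathcal A_n^*)_{n\ge 0}$ be a directive sequence, i.e. a sequence of nonerasing morphisms between free monoids over finite nonempty alphabets. For $n\le m$ put $\tau_{[n,m)}=\tau_n\circ\tau_{n+1}\circ\cdots\circ\tau_{m-1}$ (the identity if $n=m$). Let $|w|$ be the length of a word $w$ and $|w|_a$ the number of occurrences of the letter $a$ in $w$. Let $X_{\boldsymbol\tau}^{(n)}$ be the set of all $x\in\mathcal A_n^{\mathbb Z}$ such that every finite word occurring in $x$ occurs in $\tau_{[n,N)}(c)$ for some $N>n$ and $c\in\mathcal A_N$. Put $X_{\boldsymbol\tau}=X_{\boldsymbol\tau}^{(0)}$, with the shift $S$, $(Sx)_n=x_{n+1}$. Nonerasing morphisms act on bi-infinite sequences by concatenation, with the image of $x_0x_1\cdots$ starting at coordinate $0$. For $a\in\mathcal A_n$ let $$B_n(a)=\tau_{[0,n)}\bigl(\{y\in X_{\boldsymbol\tau}^{(n)}:y_0=a\}\bigr),\qquad \mathcal T_n(a)=\bigcup_{0\le k<|\tau_{[0,n)}(a)|}S^kB_n(a).$$ The sequence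 $\boldsymbol\tau$ is *primitive* if for every $n$ there is $N>n$ such that every letter of $\mathcal A_n$ occurs in $\tau_{[n,N)}(c)$ for every $c\in\mathcal A_N$. It is *recognizable* if for every $n\ge0$ the sets $S^kB_n(a)$, $a\in\mathcal A_n$, $0\le k<|\tau_{[0,n)}(a)|$, form a partition of $X_{\boldsymbol\tau}$ (sets with different indices $(a,k)$ being disjoint). Let $\mu$ be an invariant probability measure on $X_{\boldsymbol\tau}$. A point $x\in X_{\boldsymbol\tau}$ is *$\mu$-generic* if for every continuous $f:X_{\boldsymbol\tau}\to\mathbb R$ both $\frac1N\sum_{k=0}^{N-1}f(S^kx)$ and $\frac1N\sum_{k=0}^{N-1}f(S^{-k}x)$ converge to $\int f\,d\mu$ as $N\to\infty$. For nonempty $\mathcal A'_n\subseteq\mathcal A_n$, $n\ge 0$, the sequence $\boldsymbol\tau$ is *$(\mathcal A'_n)_{n\ge0}$-adapted to $\mu$* if $\sum_{n\ge0}\mu\bigl(X_{\boldsymbol\tau}\setminus\bigcup_{a\in\mathcal A'_n}\mathcal T_n(a)\bigr)<\infty$ and there is $\delta>0$ with $\mu(\mathcal T_n(a))\ge\delta$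 for all $n\ge0$ and $a\in\mathcal A'_n$. **Proposition.** Let $\boldsymbol\tau$ be a primitive and recognizable directive sequence, let $\mu$ be an ergodic (invariant probability) measure of $(X_{\boldsymbol\tau},S)$, and let $(b_m)_{m\ge0}$ be a sequence of letters with $b_m\in\mathcal A_m$. Suppose that at least one of the following conditions holds: 1. there is a $\mu$-generic point $x\in X_{\boldsymbol\tau}$ such that $x\in\mathcal T_m(b_m)$ for all $m\ge0$; 2. $\liminf_{m\to\infty}\mu(\mathcal T_m(b_m))>0$; 3. there are nonempty $\mathcal A'_n\subseteq\mathcal A_n$, $n\ge0$, such that $\boldsymbol\tau$ is $(\mathcal A'_n)_{n\ge0}$-adapted to $\mu$ and $b_m\in\mathcal A'_m$ for all $m\ge0$; 4. $(X_{\boldsymbol\tau},S)$ is uniquely ergodic, i.e. has exactly one invariant probability measure. Then for every $n\ge0$ and every $a\in\mathcal A_n$, $$\lim_{m\to\infty}\frac{|\tau_{[n,m)}(b_m)|_a}{|\tau_{[0,m)}(b_m)|}=\mu(B_n(a)).$$ -/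

import Mathlib

open Filter Topology MeasureTheory

noncomputable section

namespace SAdic

/-- The word `x_i x_{i+1} ⋯ x_{i+ℓ-1}` read in the bi-infinite sequence `x`. -/
def word {α : Type*} (x : ℤ → α) (i : ℤ) (ℓ : ℕ) : FreeMonoid α :=
  FreeMonoid.ofList (List.ofFn fun j : Fin ℓ => x (i + (j : ℤ)))

/-- The (two-sided) shift map, `(S x)_n = x_{n+1}`. -/
def shift {α : Type*} : Equiv.Perm (ℤ → α) where
  toFun x n := x (n + 1)
  invFun x n := x (n - 1)
  left_inv x := by funext n; simp
  right_inv x := by funext n; simp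

/-- The number `|w|_a` of occurrences of the letter `a` in the word `w`. -/
def letterCount {α : Type*} [DecidableEq α] (a : α) (w : FreeMonoid α) : ℕ :=
  w.toList.count a

/-- The composition matrix of a morphism of free monoids. -/
def compositionMatrix {α β : Type*} [DecidableEq β] (σ : FreeMonoid α →* FreeMonoid β) :
    Matrix β α ℕ :=
  fun b a => letterCount b (σ (FreeMonoid.of a))

/-- The extension of a nonerasing morphism to bi-infinite sequences, by concatenation:
`⋯ σ(x_{-2}) σ(x_{-1}) . σ(x_0) σ(x_1) ⋯`.
The coordinate `n ≥ 0` is the letter of index `n` of `σ(x_0 ⋯ x_n)`, and the coordinate `-(n+1)` is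
the letter of index `n`, counted from the end, of `σ(x_{-(n+1)} ⋯ x_{-1})`; both words have length
at least `n + 1` as `σ` is nonerasing, so the default value of `getD` is never used. -/
def extend {α β : Type*} [Nonempty β] (σ : FreeMonoid α →* FreeMonoid β) (x : ℤ → α) : ℤ → β
  | Int.ofNat n => (σ (word x 0 (n + 1))).toList.getD n (Classical.arbitrary β)
  | Int.negSucc n =>
      (σ (word x (Int.negSucc n) (n + 1))).toList.reverse.getD n (Classical.arbitrary β)

/-- A directive sequence `(τ_n : A_{n+1}^* → A_n^*)_{n ≥ 0}` of nonerasing morphisms. -/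
structure DirectiveSequence (A : ℕ → Type*) where
  /-- the morphism `τ_n` -/
  map : ∀ n, FreeMonoid (A (n + 1)) →* FreeMonoid (A n)
  nonerasing : ∀ n (a : A (n + 1)), map n (FreeMonoid.of a) ≠ 1

namespace DirectiveSequence

variable {A : ℕ → Type*}

/-- `τ_{[n,m)} = τ_n ∘ τ_{n+1} ∘ ⋯ ∘ τ_{m-1}` for `n ≤ m` (the identity for `n = m`). -/
def comp (τ : DirectiveSequence A) {n m : ℕ} (h : n ≤ m) :
    FreeMonoid (A m) →* FreeMonoid (A n) :=
  Nat.leRec (motive := fun m _ => FreeMonoid (A m) →* FreeMonoid (A n))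
    (MonoidHom.id _) (fun k _ f => f.comp (τ.map k)) h

/-- The word `τ_{[n,m)}(b)`, for a letter `b` of `A_m`. -/
def image (τ : DirectiveSequence A) {n m : ℕ} (h : n ≤ m) (b : A m) : FreeMonoid (A n) :=
  τ.comp h (FreeMonoid.of b)

/-- The length `|τ_{[0,n)}(a)|`, which is the height of the tower indexed by `a`. -/
def height (τ : DirectiveSequence A) (n : ℕ) (a : A n) : ℕ :=
  (τ.image (Nat.zero_le n) a).length

/-- Primitivity: for every `n` some `M_{τ_{[n,N)}}`, `N > n`, has only positive entries. -/
def Primitive [∀ n, DecidableEq (A n)] (τ : DirectiveSequence A) : Prop :=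
  ∀ n, ∃ (N : ℕ) (h : n < N), ∀ (a : A n) (b : A N), 0 < compositionMatrix (τ.comp h.le) a b

/-- The language of level `n`: the words that occur in some `τ_{[n,N)}(a)`, `N > n`. -/
def language (τ : DirectiveSequence A) (n : ℕ) : Set (FreeMonoid (A n)) :=
  {w | ∃ (N : ℕ) (h : n < N) (a : A N), w.toList <:+: (τ.image h.le a).toList}

/-- The subshift `X_τ^{(n)}` generated by the language of level `n`. -/
def subshift (τ : DirectiveSequence A) (n : ℕ) : Set (ℤ → A n) :=
  {x | ∀ (i : ℤ) (ℓ : ℕ), word x i ℓ ∈ τ.language n}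

theorem shift_mem_subshift_iff (τ : DirectiveSequence A) (n : ℕ) (x : ℤ → A n) :
    shift x ∈ τ.subshift n ↔ x ∈ τ.subshift n := by
  have key : ∀ (i : ℤ) (ℓ : ℕ), word (shift x) i ℓ = word x (i + 1) ℓ := by
    intro i ℓ
    unfold word shift
    congr 2
    funext j
    change x (i + (j : ℤ) + 1) = x (i + 1 + (j : ℤ))
    congr 1
    ring
  constructor
  · intro h i ℓ
    have h1 := h (i - 1) ℓ
    rw [key, sub_add_cancel] at h1
    exact h1
  · intro h i ℓ
    rw [key]
    exact h (i + 1) ℓ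

/-- The shift map `S` of the subshift `X_τ = X_τ^{(0)}`. -/
def S (τ : DirectiveSequence A) : Equiv.Perm (τ.subshift 0) :=
  Equiv.Perm.subtypePerm shift (τ.shift_mem_subshift_iff 0)

section Towers

variable [Nonempty (A 0)]

/-- The base `B_n(a) = τ_{[0,n)}([a])`, where `[a]` is the cylinder of `X_τ^{(n)}`. -/
def base (τ : DirectiveSequence A) (n : ℕ) (a : A n) : Set (ℤ → A 0) :=
  extend (τ.comp (Nat.zero_le n)) '' {y | y ∈ τ.subshift n ∧ y 0 = a}

/-- The level `S^k B_n(a)` of the tower indexed by `a`. -/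
def level (τ : DirectiveSequence A) (n : ℕ) (a : A n) (k : ℕ) : Set (ℤ → A 0) :=
  (shift ^ k : Equiv.Perm (ℤ → A 0)) '' τ.base n a

/-- The tower `T_n(a)`, the union of the `S^k B_n(a)`, `0 ≤ k < |τ_{[0,n)}(a)|`. -/
def tower (τ : DirectiveSequence A) (n : ℕ) (a : A n) : Set (ℤ → A 0) :=
  ⋃ k ∈ Set.Iio (τ.height n a), τ.level n a k

/-- Recognizability: for every `n`, the sets `S^k B_n(a)`, `a ∈ A_n`, `0 ≤ k < |τ_{[0,n)}(a)|`,
form a partition of `X_τ` (sets with different indices `(a, k)` are disjoint). -/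
def Recognizable (τ : DirectiveSequence A) : Prop :=
  ∀ n, (Pairwise fun p q : (a : A n) × Fin (τ.height n a) =>
      Disjoint (τ.level n p.1 p.2) (τ.level n q.1 q.2)) ∧
    ⋃ p : (a : A n) × Fin (τ.height n a), τ.level n p.1 p.2 = τ.subshift 0

/-- `τ` is `(A'_n)`-weakly-adapted to `μ`: the sum of the `μ(X_τ ∖ T'_n)` is finite, where `T'_n` is
the union of the towers `T_n(a)`, `a ∈ A'_n`. -/
def WeaklyAdapted [MeasurableSpace (A 0)] (τ : DirectiveSequence A) (A' : ∀ n, Set (A n))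
    (μ : Measure (τ.subshift 0)) : Prop :=
  (∀ n, (A' n).Nonempty) ∧
    ∑' n, μ (Subtype.val ⁻¹' (τ.subshift 0 \ ⋃ a ∈ A' n, τ.tower n a)) < ⊤

/-- `τ` is `(A'_n)`-adapted to `μ`: weakly adapted, and the measures of the towers `T_n(a)`,
`a ∈ A'_n`, `n ≥ 0`, are bounded below by some `δ > 0`. -/
def Adapted [MeasurableSpace (A 0)] (τ : DirectiveSequence A) (A' : ∀ n, Set (A n))
    (μ : Measure (τ.subshift 0)) : Prop :=
  τ.WeaklyAdapted A' μ ∧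
    ∃ δ : ℝ, 0 < δ ∧ ∀ n, ∀ a ∈ A' n, δ ≤ μ.real (Subtype.val ⁻¹' τ.tower n a)

end Towers

end DirectiveSequence

/-- `x` is generic for `μ` under the invertible map `T`: for every continuous function, the
Birkhoff averages along the forward orbit and those along the backward orbit of `x` both converge
to the integral. -/
def IsGeneric {X : Type*} [TopologicalSpace X] [MeasurableSpace X] (T : Equiv.Perm X)
    (μ : Measure X) (x : X) : Prop :=
  ∀ f : C(X, ℝ),
    Tendsto (fun N : ℕ => (∑ k ∈ Finset.range N, f ((T ^ k) x)) / (N : ℝ)) atTop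
      (𝓝 (∫ y, f y ∂μ)) ∧
    Tendsto (fun N : ℕ => (∑ k ∈ Finset.range N, f ((T⁻¹ ^ k) x)) / (N : ℝ)) atTop
      (𝓝 (∫ y, f y ∂μ))

/-- Unique ergodicity: there is exactly one invariant probability measure. -/
def UniquelyErgodic {X : Type*} [MeasurableSpace X] (T : X → X) : Prop :=
  ∃! ν : Measure X, IsProbabilityMeasure ν ∧ MeasurePreserving T ν ν

end SAdic

end

/-! By recognizability, a point of $B_m(b_m)$ visits $B_n(a)$ exactly $|\tau_{[n,m)}(b_m)|_a$ times
while it climbs its tower (`sum_indicator_base`). The quotient in the theorem is therefore a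
Birkhoff average of the indicator of $B_n(a)$ over $|\tau_{[0,m)}(b_m)|$ steps. This indicator is
continuous because $B_n(a)$ is clopen, and the heights tend to infinity by primitivity
(`tendsto_height`).

For a generic $x\in\mathcal T_m(b_m)$, the orbit segment along the tower splits at $x$ into a
backward and a forward piece. Genericity controls both, uniformly in the position of $x$
(`tendsto_add_div_of_tendsto_div`).

In the other cases, probability measures carried by $B_m(b_m)$ are averaged along the tower: the
integral of the indicator is then exactly the quotient. Every weak limit of these averages is
invariant (`measurePreserving_of_tendsto_orbitAverage`), so by compactness it suffices to identify
each such limit with $\mu$. Under unique ergodicity Dirac masses will do. If the towers have measure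
at least $\delta$, which conditions 2 and 3 both provide for large $m$, one conditions $\mu$ on
$B_m(b_m)$. The averages are then at most $\delta^{-1}\mu$, so the limits are absolutely continuous
with respect to $\mu$ (`absolutelyContinuous_of_tendsto`) and equal $\mu$ by ergodicity. -/

namespace SAdic

/-! ### Words, and images of bi-infinite sequences described by cutting points -/

section Words

variable {α β γ : Type*}

theorem length_word (x : ℤ → α) (i : ℤ) (ℓ : ℕ) : (word x i ℓ).length = ℓ := by
  simp [word, FreeMonoid.length]

theorem word_zero (x : ℤ → α) (i : ℤ) : word x i 0 = 1 := rfl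

theorem word_one (x : ℤ → α) (i : ℤ) : word x i 1 = FreeMonoid.of (x i) := by
  simp [word, List.ofFn_succ]

theorem word_add (x : ℤ → α) (i : ℤ) (k ℓ : ℕ) :
    word x i (k + ℓ) = word x i k * word x (i + k) ℓ := by
  unfold word
  rw [← FreeMonoid.ofList_append, List.ofFn_add]
  congr 3
  funext j
  simp [add_assoc]

theorem word_succ (x : ℤ → α) (i : ℤ) (k : ℕ) :
    word x i (k + 1) = word x i k * FreeMonoid.of (x (i + k)) := by
  rw [word_add, word_one]

theorem word_succ' (x : ℤ → α) (i : ℤ) (k : ℕ) :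
    word x i (k + 1) = FreeMonoid.of (x i) * word x (i + 1) k := by
  rw [add_comm, word_add, word_one]; simp

theorem word_shift_pow (x : ℤ → α) (k : ℕ) (i : ℤ) :
    ((shift ^ k : Equiv.Perm (ℤ → α)) x) i = x (i + k) := by
  induction k generalizing i with
  | zero => simp
  | succ k ih =>
    rw [pow_succ', Equiv.Perm.mul_apply]
    change ((shift ^ k : Equiv.Perm (ℤ → α)) x) (i + 1) = _
    rw [ih]
    push_cast
    congr 1
    ring

theorem getElem_toList_word (x : ℤ → α) (i : ℤ) (ℓ k : ℕ)
    (hk : k < (word x i ℓ).toList.length) : (word x i ℓ).toList[k] = x (i + k) := by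
  simp [word]

theorem word_eq_iff (x : ℤ → α) (i : ℤ) (w : FreeMonoid α) :
    word x i w.length = w ↔ ∀ (k : ℕ) (hk : k < w.toList.length), w.toList[k] = x (i + k) := by
  constructor
  · intro h k hk
    have hk' : k < (word x i w.length).toList.length := by rw [h]; exact hk
    rw [← getElem_toList_word x i w.length k hk']
    congr 1
    rw [h]
  · intro h
    apply FreeMonoid.toList.injective
    apply List.ext_getElem
    · exact length_word _ _ _
    · intro k h1 h2
      rw [getElem_toList_word, h k h2]

theorem length_le_of_mem (σ : FreeMonoid α →* FreeMonoid β) {w : FreeMonoid α} {c : α}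
    (hc : c ∈ w.toList) : (σ (FreeMonoid.of c)).length ≤ (σ w).length := by
  obtain ⟨s, t, h⟩ := List.append_of_mem hc
  have h' : w = FreeMonoid.ofList s * (FreeMonoid.of c * FreeMonoid.ofList t) := h
  rw [h', map_mul, map_mul, FreeMonoid.length_mul, FreeMonoid.length_mul]
  omega

theorem map_isInfix (σ : FreeMonoid α →* FreeMonoid β) {v w : FreeMonoid α}
    (h : v.toList <:+: w.toList) : (σ v).toList <:+: (σ w).toList := by
  obtain ⟨s, t, h⟩ := h
  have h' : w = FreeMonoid.ofList s * v * FreeMonoid.ofList t := h.symm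
  exact ⟨(σ (FreeMonoid.ofList s)).toList, (σ (FreeMonoid.ofList t)).toList, by
    rw [h', map_mul σ, map_mul σ]; rfl⟩

theorem word_isInfix (x : ℤ → α) {i j : ℤ} {k ℓ : ℕ} (h : i ≤ j) (h' : j + k ≤ i + ℓ) :
    (word x j k).toList <:+: (word x i ℓ).toList := by
  obtain ⟨d, rfl⟩ := Int.le.dest h
  obtain ⟨e, rfl⟩ : ∃ e, ℓ = d + k + e := ⟨ℓ - (d + k), by omega⟩
  rw [word_add, word_add]
  exact ⟨_, _, rfl⟩

/-- A morphism of free monoids is nonerasing if no letter is mapped to the empty word. -/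
def Nonerasing (σ : FreeMonoid α →* FreeMonoid β) : Prop :=
  ∀ a, 0 < (σ (FreeMonoid.of a)).length

theorem Nonerasing.length_le {σ : FreeMonoid α →* FreeMonoid β} (hσ : Nonerasing σ)
    (w : FreeMonoid α) : w.length ≤ (σ w).length := by
  induction w using FreeMonoid.inductionOn' with
  | one => simp
  | of_mul a w ih =>
    rw [map_mul, FreeMonoid.length_mul, FreeMonoid.length_mul, FreeMonoid.length_of]
    have := hσ a
    omega

theorem Nonerasing.comp {σ : FreeMonoid β →* FreeMonoid γ} {ρ : FreeMonoid α →* FreeMonoid β}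
    (hσ : Nonerasing σ) (hρ : Nonerasing ρ) : Nonerasing (σ.comp ρ) := fun a =>
  (hρ a).trans_le (hσ.length_le _)

/-- `x` is the concatenation of the words `σ(y_j)`, the word `σ(y_j)` starting at the coordinate
`p j`, and `p 0 = 0`. -/
structure IsImage (σ : FreeMonoid α →* FreeMonoid β) (y : ℤ → α) (x : ℤ → β) (p : ℤ → ℤ) :
    Prop where
  zero : p 0 = 0
  succ : ∀ j, p (j + 1) = p j + (σ (FreeMonoid.of (y j))).length
  word_of : ∀ j, word x (p j) (σ (FreeMonoid.of (y j))).length = σ (FreeMonoid.of (y j))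

namespace IsImage

variable {σ : FreeMonoid α →* FreeMonoid β} {y : ℤ → α} {x : ℤ → β} {p : ℤ → ℤ}

theorem word_eq (h : IsImage σ y x p) (i : ℤ) (ℓ : ℕ) :
    p (i + ℓ) = p i + (σ (word y i ℓ)).length ∧
      word x (p i) (σ (word y i ℓ)).length = σ (word y i ℓ) := by
  induction ℓ with
  | zero => simp [word_zero]
  | succ ℓ ih =>
    obtain ⟨h1, h2⟩ := ih
    rw [word_succ, map_mul, FreeMonoid.length_mul]
    constructor
    · push_cast
      rw [← add_assoc, h.succ, h1, add_assoc]
    · rw [word_add, h2, ← h1, h.word_of]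

theorem exists_eq_add (h : IsImage σ y x p) (hσ : Nonerasing σ) (k : ℤ) :
    ∃ (j : ℤ) (i : ℕ), i < (σ (FreeMonoid.of (y j))).length ∧ k = p j + i := by
  induction k using Int.induction_on with
  | zero => exact ⟨0, 0, hσ _, by simp [h.zero]⟩
  | succ k ih =>
    obtain ⟨j, i, hi, hk⟩ := ih
    by_cases hi' : i + 1 < (σ (FreeMonoid.of (y j))).length
    · exact ⟨j, i + 1, hi', by push_cast; omega⟩
    · exact ⟨j + 1, 0, hσ _, by have := h.succ j; push_cast; omega⟩
  | pred k ih =>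
    obtain ⟨j, i, hi, hk⟩ := ih
    rcases i with _ | i
    · have h1 := h.succ (j - 1)
      have h2 := hσ (y (j - 1))
      rw [sub_add_cancel] at h1
      exact ⟨j - 1, (σ (FreeMonoid.of (y (j - 1)))).length - 1, by omega, by omega⟩
    · exact ⟨j, i, by omega, by push_cast at hk; omega⟩

/-- The normalisation at 0 and the block lengths determine all cutting points, and the blocks cover
ℤ. This characterises `extend` without computing with its definition. -/
theorem unique {x' : ℤ → β} {p' : ℤ → ℤ} (h : IsImage σ y x p) (h' : IsImage σ y x' p')
    (hσ : Nonerasing σ) : x = x' := by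
  have hp : ∀ j, p j = p' j := by
    intro j
    induction j using Int.induction_on with
    | zero => rw [h.zero, h'.zero]
    | succ k ih => rw [h.succ, h'.succ, ih]
    | pred k ih =>
      have h1 := h.succ (-k - 1)
      have h2 := h'.succ (-k - 1)
      rw [sub_add_cancel] at h1 h2
      omega
  funext k
  obtain ⟨j, i, hi, rfl⟩ := h.exists_eq_add hσ k
  rw [← (word_eq_iff _ _ _).1 (h.word_of j) i hi, hp,
    ← (word_eq_iff _ _ _).1 (h'.word_of j) i hi]

theorem comp {ρ : FreeMonoid γ →* FreeMonoid α} {z : ℤ → γ} {q : ℤ → ℤ}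
    (h : IsImage σ y x p) (h' : IsImage ρ z y q) :
    IsImage (σ.comp ρ) z x (p ∘ q) where
  zero := by simp [h.zero, h'.zero]
  succ j := by
    have := (h.word_eq (q j) (ρ (FreeMonoid.of (z j))).length).1
    rw [h'.word_of] at this
    simp only [Function.comp, h'.succ, this, MonoidHom.comp_apply]
  word_of j := by
    have := (h.word_eq (q j) (ρ (FreeMonoid.of (z j))).length).2
    rw [h'.word_of] at this
    exact this

/-- Moving the origin to the cutting point `p j` amounts to shifting the preimage by `j`. -/
theorem shift_pow (h : IsImage σ y x p) (j k : ℕ) (hk : p j = k) :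
    IsImage σ ((shift ^ j : Equiv.Perm (ℤ → α)) y) ((shift ^ k : Equiv.Perm (ℤ → β)) x)
      (fun i => p (i + j) - k) where
  zero := by simp [hk]
  succ i := by
    rw [word_shift_pow, add_right_comm, h.succ]
    ring
  word_of i := by
    rw [word_shift_pow, word_eq_iff]
    intro l hl
    rw [word_shift_pow, (word_eq_iff _ _ _).1 (h.word_of (i + j)) l hl]
    congr 1
    ring

theorem le_apply (h : IsImage σ y x p) (hσ : Nonerasing σ) (j : ℕ) :
    (j : ℤ) ≤ p j ∧ p (-j) ≤ -j := by
  induction j with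
  | zero => simp [h.zero]
  | succ j ih =>
    have h1 := h.succ j
    have h2 := h.succ (-(j : ℤ) - 1)
    have h3 := hσ (y j)
    have h4 := hσ (y (-(j : ℤ) - 1))
    rw [sub_add_cancel] at h2
    have e : (-((j + 1 : ℕ) : ℤ)) = -(j : ℤ) - 1 := by push_cast; ring
    rw [e]
    push_cast
    constructor <;> omega

theorem word_isInfix (h : IsImage σ y x p) (hσ : Nonerasing σ) (i : ℤ) (ℓ : ℕ) :
    ∃ (j : ℤ) (k : ℕ), (word x i ℓ).toList <:+: (σ (word y j k)).toList := by
  obtain ⟨n, h1, h2⟩ : ∃ n : ℕ, -(n : ℤ) ≤ i ∧ i + ℓ ≤ n :=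
    ⟨(-i).toNat + (i + ℓ).toNat, by omega, by omega⟩
  have h3 := h.le_apply hσ n
  refine ⟨-n, n + n, ?_⟩
  have h4 := h.word_eq (-n) (n + n)
  rw [← h4.2]
  apply SAdic.word_isInfix
  · omega
  · rw [← h4.1]
    push_cast
    rw [neg_add_cancel_left]
    omega

end IsImage

/-! ### The extension of a nonerasing morphism to bi-infinite sequences -/

section Extend

variable [Nonempty β] {σ : FreeMonoid α →* FreeMonoid β}

theorem extend_natCast (hσ : Nonerasing σ) (y : ℤ → α) {k M : ℕ}
    (hk : k < (σ (word y 0 M)).toList.length) :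
    extend σ y k = (σ (word y 0 M)).toList[k] := by
  have key : ∀ M N, M ≤ N → k < (σ (word y 0 M)).toList.length →
      (σ (word y 0 N)).toList[k]? = (σ (word y 0 M)).toList[k]? := by
    intro M N hMN hk
    obtain ⟨d, rfl⟩ := Nat.exists_eq_add_of_le hMN
    rw [word_add, map_mul, FreeMonoid.toList_mul, List.getElem?_append_left hk]
  have hk' : k < (σ (word y 0 (k + 1))).toList.length := by
    have := hσ.length_le (word y 0 (k + 1))
    rw [length_word] at this
    exact this
  change (σ (word y 0 (k + 1))).toList.getD k _ = _
  have := (key _ _ (le_max_left M (k + 1)) hk).symm.trans (key _ _ (le_max_right M (k + 1)) hk')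
  rw [List.getD_eq_getElem?_getD, ← this, List.getElem?_eq_getElem hk, Option.getD_some]

theorem extend_negSucc (hσ : Nonerasing σ) (y : ℤ → α) {k M : ℕ}
    (hk : k < (σ (word y (-M) M)).toList.reverse.length) :
    extend σ y (Int.negSucc k) = (σ (word y (-M) M)).toList.reverse[k] := by
  have key : ∀ M N : ℕ, M ≤ N → k < (σ (word y (-M) M)).toList.reverse.length →
      (σ (word y (-N) N)).toList.reverse[k]? = (σ (word y (-M) M)).toList.reverse[k]? := by
    intro M N hMN hk
    obtain ⟨d, rfl⟩ := Nat.exists_eq_add_of_le' hMN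
    rw [word_add, map_mul, FreeMonoid.toList_mul, List.reverse_append]
    have e : -((d + M : ℕ) : ℤ) + d = -M := by push_cast; ring
    rw [e, List.getElem?_append_left hk]
  have hk' : k < (σ (word y (-(k + 1 : ℕ)) (k + 1))).toList.reverse.length := by
    have := hσ.length_le (word y (-(k + 1 : ℕ)) (k + 1))
    rw [length_word] at this
    rw [List.length_reverse]
    exact this
  change (σ (word y (-(k + 1 : ℕ)) (k + 1))).toList.reverse.getD k _ = _
  have := (key _ _ (le_max_left M (k + 1)) hk).symm.trans (key _ _ (le_max_right M (k + 1)) hk')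
  rw [List.getD_eq_getElem?_getD, ← this, List.getElem?_eq_getElem hk, Option.getD_some]

/-- One formula gives the cutting points on both sides of 0: `toNat` makes the second word empty for
`j ≥ 0` and the first one empty for `j ≤ 0`. -/
theorem isImage_extend (hσ : Nonerasing σ) (y : ℤ → α) :
    IsImage σ y (extend σ y) (fun j =>
      (σ (word y 0 j.toNat)).length - (σ (word y j (-j).toNat)).length) where
  zero := by simp [word_zero]
  succ j := by
    obtain ⟨n, rfl | rfl⟩ : ∃ n : ℕ, j = n ∨ j = -((n + 1 : ℕ) : ℤ) := by
      rcases j with n | n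
      · exact ⟨n, .inl rfl⟩
      · exact ⟨n, .inr rfl⟩
    · have e1 : (-((n : ℤ) + 1)).toNat = 0 := by omega
      have e2 : (-(n : ℤ)).toNat = 0 := by omega
      have e3 : ((n : ℤ) + 1).toNat = n + 1 := by omega
      simp only [e1, e2, e3, Int.toNat_natCast, word_zero, word_succ, map_mul,
        FreeMonoid.length_mul, map_one, FreeMonoid.length_one, zero_add]
      push_cast
      ring
    · have e1 : (-(-((n + 1 : ℕ) : ℤ))).toNat = n + 1 := by omega
      have e2 : (-(-((n + 1 : ℕ) : ℤ) + 1)).toNat = n := by omega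
      have e3 : (-((n + 1 : ℕ) : ℤ) + 1).toNat = 0 := by omega
      have e4 : (-((n + 1 : ℕ) : ℤ)).toNat = 0 := by omega
      simp only [e1, e2, e3, e4, word_zero, word_succ', map_mul, FreeMonoid.length_mul, map_one,
        FreeMonoid.length_one]
      push_cast
      ring
  word_of j := by
    rw [word_eq_iff]
    intro i hi
    obtain ⟨n, rfl | rfl⟩ : ∃ n : ℕ, j = n ∨ j = -((n + 1 : ℕ) : ℤ) := by
      rcases j with n | n
      · exact ⟨n, .inl rfl⟩
      · exact ⟨n, .inr rfl⟩
    · have e2 : (-(n : ℤ)).toNat = 0 := by omega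
      have hl : (σ (word y 0 (n + 1))).toList =
          (σ (word y 0 n)).toList ++ (σ (FreeMonoid.of (y n))).toList := by
        rw [word_succ, map_mul, FreeMonoid.toList_mul, zero_add]
      simp only [e2, Int.toNat_natCast, word_zero, map_one, FreeMonoid.length_one]
      have e : ((σ (word y 0 n)).length : ℤ) - ((0 : ℕ) : ℤ) + i =
          (((σ (word y 0 n)).toList.length + i : ℕ) : ℤ) := by
        rw [FreeMonoid.length]; push_cast; ring
      rw [e, extend_natCast hσ y (M := n + 1)
        (by rw [hl, List.length_append]; omega)]
      simp [hl]
    · have e1 : (-(-((n + 1 : ℕ) : ℤ))).toNat = n + 1 := by omega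
      have e4 : (-((n + 1 : ℕ) : ℤ)).toNat = 0 := by omega
      have hl : (σ (word y (-((n + 1 : ℕ) : ℤ)) (n + 1))).toList =
          (σ (FreeMonoid.of (y (-((n + 1 : ℕ) : ℤ))))).toList ++
            (σ (word y (-((n + 1 : ℕ) : ℤ) + 1) n)).toList := by
        rw [word_succ', map_mul, FreeMonoid.toList_mul]
      have hlen := congrArg List.length hl
      rw [List.length_append] at hlen
      simp only [e1, e4, word_zero, map_one, FreeMonoid.length_one]
      have e : ((0 : ℕ) : ℤ) - (σ (word y (-((n + 1 : ℕ) : ℤ)) (n + 1))).length + i =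
          Int.negSucc ((σ (word y (-((n + 1 : ℕ) : ℤ)) (n + 1))).toList.length - 1 - i) := by
        rw [FreeMonoid.length]; omega
      rw [e, extend_negSucc hσ y (M := n + 1) (by rw [List.length_reverse]; omega),
        List.getElem_reverse]
      have e5 : (σ (word y (-((n + 1 : ℕ) : ℤ)) (n + 1))).toList.length - 1 -
          ((σ (word y (-((n + 1 : ℕ) : ℤ)) (n + 1))).toList.length - 1 - i) = i := by omega
      simp only [e5]
      simp only [hl, List.getElem_append_left hi]

theorem IsImage.eq_extend (hσ : Nonerasing σ) {y : ℤ → α} {x : ℤ → β} {p : ℤ → ℤ}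
    (h : IsImage σ y x p) : x = extend σ y :=
  h.unique (isImage_extend hσ y) hσ

theorem continuous_extend [Finite α] [TopologicalSpace α] [DiscreteTopology α]
    [TopologicalSpace β] (σ : FreeMonoid α →* FreeMonoid β) :
    Continuous (extend σ : (ℤ → α) → ℤ → β) := by
  have key : ∀ (i : ℤ) (ℓ : ℕ) (F : FreeMonoid α → β),
      Continuous fun y : ℤ → α => F (word y i ℓ) := by
    intro i ℓ F
    have h1 : Continuous fun (y : ℤ → α) (j : Fin ℓ) => y (i + (j : ℤ)) := by fun_prop
    exact (continuous_of_discreteTopology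
      (f := fun v : Fin ℓ → α => F (FreeMonoid.ofList (List.ofFn v)))).comp h1
  refine continuous_pi fun k => ?_
  rcases k with n | n
  · exact key 0 (n + 1) fun w => (σ w).toList.getD n (Classical.arbitrary β)
  · exact key (Int.negSucc n) (n + 1) fun w => (σ w).toList.reverse.getD n (Classical.arbitrary β)

end Extend

end Words

/-! ### Compositions, languages and growth of heights -/

namespace DirectiveSequence

variable {A : ℕ → Type*} (τ : DirectiveSequence A)

theorem comp_self (n : ℕ) : τ.comp (le_refl n) = MonoidHom.id _ := by
  unfold comp
  rw [Nat.leRec_self]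

theorem comp_succ {n m : ℕ} (h : n ≤ m) :
    τ.comp (Nat.le_succ_of_le h) = (τ.comp h).comp (τ.map m) := by
  unfold comp
  rw [Nat.leRec_succ]

theorem comp_trans {n m k : ℕ} (h : n ≤ m) (h' : m ≤ k) :
    τ.comp (h.trans h') = (τ.comp h).comp (τ.comp h') := by
  induction k, h' using Nat.le_induction with
  | base => rw [comp_self, MonoidHom.comp_id]
  | succ k h' ih =>
    rw [τ.comp_succ h', ← MonoidHom.comp_assoc, ← ih, ← τ.comp_succ (h.trans h')]

theorem nonerasing_comp {n m : ℕ} (h : n ≤ m) : Nonerasing (τ.comp h) := by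
  induction m, h using Nat.le_induction with
  | base => intro a; simp [comp_self]
  | succ m h ih =>
    rw [τ.comp_succ h]
    refine ih.comp fun a => ?_
    rw [Nat.pos_iff_ne_zero, Ne, FreeMonoid.length_eq_zero]
    exact τ.nonerasing m a

theorem height_pos (n : ℕ) (a : A n) : 0 < τ.height n a :=
  τ.nonerasing_comp (Nat.zero_le n) a

theorem image_trans {n m k : ℕ} (h : n ≤ m) (h' : m ≤ k) (b : A k) :
    τ.image (h.trans h') b = τ.comp h (τ.image h' b) := by
  rw [image, τ.comp_trans h h']
  rfl

theorem mem_language_of_isInfix {n : ℕ} {v w : FreeMonoid (A n)} (hw : w ∈ τ.language n)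
    (h : v.toList <:+: w.toList) : v ∈ τ.language n := by
  obtain ⟨N, hN, a, ha⟩ := hw
  exact ⟨N, hN, a, h.trans ha⟩

theorem comp_mem_language {n m : ℕ} (h : n ≤ m) {w : FreeMonoid (A m)} (hw : w ∈ τ.language m) :
    τ.comp h w ∈ τ.language n := by
  obtain ⟨N, hN, a, ha⟩ := hw
  refine ⟨N, h.trans_lt hN, a, ?_⟩
  rw [τ.image_trans h hN.le]
  exact map_isInfix _ ha

theorem mem_subshift_of_isImage {n m : ℕ} (h : n ≤ m) {y : ℤ → A m} {z : ℤ → A n} {p : ℤ → ℤ}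
    (hz : IsImage (τ.comp h) y z p) (hy : y ∈ τ.subshift m) : z ∈ τ.subshift n := by
  intro i ℓ
  obtain ⟨j, k, hjk⟩ := hz.word_isInfix (τ.nonerasing_comp h) i ℓ
  exact τ.mem_language_of_isInfix (τ.comp_mem_language h (hy j k)) hjk

theorem shift_pow_mem_subshift {n : ℕ} {x : ℤ → A n} (hx : x ∈ τ.subshift n) (k : ℕ) :
    (shift ^ k : Equiv.Perm (ℤ → A n)) x ∈ τ.subshift n := by
  induction k with
  | zero => exact hx
  | succ k ih =>
    rw [pow_succ', Equiv.Perm.mul_apply]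
    exact (τ.shift_mem_subshift_iff n _).2 ih

theorem S_pow_coe (k : ℕ) (x : τ.subshift 0) :
    (((τ.S ^ k : Equiv.Perm (τ.subshift 0)) x : τ.subshift 0) : ℤ → A 0) =
      (shift ^ k : Equiv.Perm (ℤ → A 0)) (x : ℤ → A 0) := by
  induction k generalizing x with
  | zero => rfl
  | succ k ih =>
    rw [pow_succ, pow_succ, Equiv.Perm.mul_apply, Equiv.Perm.mul_apply, ih]
    rfl

/-- Since the language has words of length `L`, some letter `c` has height at least `L`. Primitivity
puts `c` into the image of every letter of a later level `M`, and the image in level `M` of any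
letter of a level `m ≥ M` contains some letter. -/
theorem exists_le_height [∀ n, DecidableEq (A n)] (hprim : τ.Primitive)
    (hne : (τ.subshift 0).Nonempty) (L : ℕ) : ∃ M, ∀ m ≥ M, ∀ b : A m, L ≤ τ.height m b := by
  obtain ⟨x, hx⟩ := hne
  obtain ⟨N, hN, c, hc⟩ := hx 0 L
  have hL : L ≤ τ.height N c := by
    have := hc.length_le
    rwa [show (word x 0 L).toList.length = L from length_word x 0 L] at this
  obtain ⟨M, hM, hpos⟩ := hprim N
  refine ⟨M, fun m hm b => hL.trans ?_⟩
  have hmb := τ.nonerasing_comp hm b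
  obtain ⟨d, hd⟩ := List.exists_mem_of_length_pos hmb
  have h1 := length_le_of_mem (τ.comp (Nat.zero_le M)) hd
  have h2 := length_le_of_mem (τ.comp (Nat.zero_le N)) (List.count_pos_iff.1 (hpos c d))
  have e1 := τ.image_trans (Nat.zero_le M) hm b
  have e2 := τ.image_trans (Nat.zero_le N) hM.le d
  change (τ.image (Nat.zero_le N) c).length ≤ (τ.comp _ (τ.image hM.le d)).length at h2
  change (τ.image (Nat.zero_le M) d).length ≤ (τ.comp _ (τ.image hm b)).length at h1
  rw [← e2] at h2
  rw [← e1] at h1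
  exact h2.trans h1

theorem tendsto_height [∀ n, DecidableEq (A n)] (hprim : τ.Primitive)
    (hne : (τ.subshift 0).Nonempty) (b : ∀ m, A m) :
    Tendsto (fun m => τ.height m (b m)) atTop atTop :=
  tendsto_atTop.2 fun L =>
    let ⟨M, hM⟩ := τ.exists_le_height hprim hne L
    eventually_atTop.2 ⟨M, fun m hm => hM m hm (b m)⟩

/-! ### Visits to the bases along a tower -/

section Towers

variable [Nonempty (A 0)]

theorem base_eq_level (n : ℕ) (a : A n) : τ.base n a = τ.level n a 0 := by
  simp [level]

variable {τ}

theorem Recognizable.level_subset (hrec : τ.Recognizable) (n : ℕ) (a : A n) {k : ℕ}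
    (hk : k < τ.height n a) : τ.level n a k ⊆ τ.subshift 0 := by
  rw [← (hrec n).2]
  exact Set.subset_iUnion (fun p : (a : A n) × Fin (τ.height n a) => τ.level n p.1 p.2)
    ⟨a, ⟨k, hk⟩⟩

theorem Recognizable.base_subset (hrec : τ.Recognizable) (n : ℕ) (a : A n) :
    τ.base n a ⊆ τ.subshift 0 := by
  rw [base_eq_level]
  exact hrec.level_subset n a (τ.height_pos n a)

theorem Recognizable.mem_base_iff (hrec : τ.Recognizable) {n : ℕ} {a c : A n} {k : ℕ}
    (hk : k < τ.height n c) {x : ℤ → A 0} (hx : x ∈ τ.level n c k) :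
    x ∈ τ.base n a ↔ c = a ∧ k = 0 := by
  constructor
  · intro h
    rw [base_eq_level] at h
    by_contra hne
    have hpq : (⟨c, ⟨k, hk⟩⟩ : (a : A n) × Fin (τ.height n a)) ≠ ⟨a, ⟨0, τ.height_pos n a⟩⟩ := by
      intro he
      obtain ⟨rfl, he⟩ := Sigma.mk.inj_iff.1 he
      exact hne ⟨rfl, congrArg Fin.val (eq_of_heq he)⟩
    exact Set.disjoint_left.1 ((hrec n).1 hpq) hx h
  · rintro ⟨rfl, rfl⟩
    rwa [base_eq_level]

/-- The orbit of a point of `B_m(b)` visits `B_n(a)` as often as `a` occurs in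
`τ_{[n,m)}(b)`, before leaving the tower. -/
theorem Recognizable.sum_indicator_base [∀ n, DecidableEq (A n)] (hrec : τ.Recognizable)
    {n m : ℕ} (h : n ≤ m) (a : A n) (b : A m) {x : ℤ → A 0} (hx : x ∈ τ.base m b) :
    ∑ k ∈ Finset.range (τ.height m b),
      (τ.base n a).indicator (1 : (ℤ → A 0) → ℝ) ((shift ^ k : Equiv.Perm (ℤ → A 0)) x) =
      letterCount a (τ.image h b) := by
  classical
  obtain ⟨y, ⟨hy, rfl⟩, rfl⟩ := hx
  have : Nonempty (A n) := ⟨a⟩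
  set f : (ℤ → A 0) → ℝ := (τ.base n a).indicator 1 with hf
  set σ := τ.comp (Nat.zero_le n)
  have hσ : Nonerasing σ := τ.nonerasing_comp _
  have hρ : Nonerasing (τ.comp h) := τ.nonerasing_comp h
  -- The point is factored through level `n`: it is the `σ`-image of `z`, and `z` begins with
  -- $\tau_{[n,m)}(y_0)$.
  set z := extend (τ.comp h) y with hz
  have hzy := isImage_extend hρ y
  rw [← hz] at hzy
  have hzn : z ∈ τ.subshift n := τ.mem_subshift_of_isImage h hzy hy
  have hxz := isImage_extend hσ z
  have hx : extend σ z = extend (τ.comp (Nat.zero_le m)) y := by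
    have h1 := hxz.comp hzy
    rw [← τ.comp_trans] at h1
    exact h1.eq_extend (τ.nonerasing_comp _)
  rw [← hx]
  set x := extend σ z
  set p := fun j : ℤ => ((σ (word z 0 j.toNat)).length : ℤ) - (σ (word z j (-j).toNat)).length
  have hpj : ∀ j : ℕ, p j = (σ (word z 0 j)).length := by
    intro j
    have := (hxz.word_eq 0 j).1
    rw [hxz.zero, zero_add, zero_add] at this
    exact this
  -- Between two cutting points the orbit climbs the tower of the current letter of `z`, starting
  -- from its base.
  have hlevel : ∀ (j : ℕ) (i : ℕ), (shift ^ ((σ (word z 0 j)).length + i) :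
      Equiv.Perm (ℤ → A 0)) x ∈ τ.level n (z j) i := by
    intro j i
    refine ⟨(shift ^ (σ (word z 0 j)).length : Equiv.Perm (ℤ → A 0)) x, ?_, ?_⟩
    · refine ⟨(shift ^ j : Equiv.Perm (ℤ → A n)) z,
        ⟨τ.shift_pow_mem_subshift hzn j, ?_⟩, ?_⟩
      · rw [word_shift_pow, zero_add]
      · exact ((hxz.shift_pow j _ (hpj j)).eq_extend hσ).symm
    · rw [← Equiv.Perm.mul_apply, ← pow_add, add_comm]
  -- Each letter of `z` contributes one passage through its tower, and disjointness of levels lets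
  -- only the bottom level of the tower of `a` count.
  have key : ∀ j : ℕ, ∑ k ∈ Finset.range (σ (word z 0 j)).length,
      f ((shift ^ k : Equiv.Perm (ℤ → A 0)) x) = letterCount a (word z 0 j) := by
    intro j
    induction j with
    | zero => simp [word_zero, letterCount]
    | succ j ih =>
      rw [word_succ, map_mul, FreeMonoid.length_mul, Finset.sum_range_add, ih, zero_add]
      have h1 : ∀ i ∈ Finset.range (σ (FreeMonoid.of (z j))).length,
          f ((shift ^ ((σ (word z 0 j)).length + i) : Equiv.Perm (ℤ → A 0)) x) =
            if i = 0 then (if z j = a then 1 else 0) else 0 := by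
        intro i hi
        have := hrec.mem_base_iff (a := a) (Finset.mem_range.1 hi) (hlevel j i)
        rw [hf, Set.indicator_apply, this]
        by_cases h1 : z j = a <;> by_cases h2 : i = 0 <;> simp [h1, h2]
      rw [Finset.sum_congr rfl h1, Finset.sum_ite_eq' _ 0,
        if_pos (Finset.mem_range.2 (hσ (z j)))]
      simp only [letterCount, FreeMonoid.toList_mul, FreeMonoid.toList_of, List.count_append,
        List.count_singleton]
      by_cases h1 : z j = a <;> simp [h1]
  have hw := hzy.word_of 0
  rw [hzy.zero] at hw
  have := key (τ.comp h (FreeMonoid.of (y 0))).length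
  rw [hw] at this
  rw [image, ← this]
  congr 2
  rw [height, τ.image_trans (Nat.zero_le n) h]
  rfl

/-- By primitivity `b` occurs in the image of any letter of some level `N`. A point of
$X_{\boldsymbol\tau}^{(N)}$ exists, and its image in level `m` can be shifted to bring `b` to
coordinate 0. -/
theorem Recognizable.base_nonempty [∀ n, DecidableEq (A n)] (hrec : τ.Recognizable)
    (hprim : τ.Primitive) (hne : (τ.subshift 0).Nonempty) (m : ℕ) (b : A m) :
    (τ.base m b).Nonempty := by
  obtain ⟨N, hN, hpos⟩ := hprim m
  obtain ⟨x, hx⟩ := hne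
  rw [← (hrec N).2, Set.mem_iUnion] at hx
  obtain ⟨⟨c, k⟩, x', ⟨y, ⟨hy, rfl⟩, -⟩, -⟩ := hx
  have : Nonempty (A m) := ⟨b⟩
  have hzy := isImage_extend (τ.nonerasing_comp hN.le) y
  have hz := τ.mem_subshift_of_isImage hN.le hzy hy
  obtain ⟨i, hi, hib⟩ := List.getElem_of_mem (List.count_pos_iff.1 (hpos b (y 0)))
  have hw := (word_eq_iff _ _ _).1 (hzy.word_of 0) i hi
  rw [hzy.zero, zero_add] at hw
  refine ⟨_, (shift ^ i : Equiv.Perm (ℤ → A m)) (extend (τ.comp hN.le) y),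
    ⟨τ.shift_pow_mem_subshift hz i, ?_⟩, rfl⟩
  rw [word_shift_pow, zero_add, ← hw, hib]

end Towers

/-! ### Compactness of the levels, and clopen bases -/

section Topology

theorem isClosed_subshift (n : ℕ) [Finite (A n)] [TopologicalSpace (A n)] [DiscreteTopology (A n)] :
    IsClosed (τ.subshift n) := by
  have : τ.subshift n = ⋂ (i : ℤ) (ℓ : ℕ), {x | word x i ℓ ∈ τ.language n} := by
    ext x; simp [subshift]
  rw [this]
  refine isClosed_iInter fun i => isClosed_iInter fun ℓ => ?_
  have h1 : Continuous fun (y : ℤ → A n) (j : Fin ℓ) => y (i + (j : ℤ)) := by fun_prop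
  exact (isClosed_discrete
    {v : Fin ℓ → A n | FreeMonoid.ofList (List.ofFn v) ∈ τ.language n}).preimage h1

theorem continuous_shift {α : Type*} [TopologicalSpace α] :
    Continuous (shift : (ℤ → α) → ℤ → α) :=
  continuous_pi fun n => continuous_apply (n + 1)

variable [∀ n, Finite (A n)] [TopologicalSpace (A 0)] [Nonempty (A 0)]

theorem isCompact_base (n : ℕ) (a : A n) : IsCompact (τ.base n a) := by
  let _ : TopologicalSpace (A n) := ⊥
  have : DiscreteTopology (A n) := ⟨rfl⟩
  refine IsCompact.image ?_ (continuous_extend _)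
  refine ((τ.isClosed_subshift n).inter ?_).isCompact
  exact IsClosed.preimage (f := fun y : ℤ → A n => y 0) (continuous_apply 0)
    (isClosed_discrete {a})

theorem isCompact_level (n : ℕ) (a : A n) (k : ℕ) : IsCompact (τ.level n a k) := by
  refine (τ.isCompact_base n a).image ?_
  rw [Equiv.Perm.coe_pow]
  exact continuous_shift.iterate k

variable {τ}

/-- The base is compact, and by the partition property its complement in the subshift is a finite
union of compact levels. -/
theorem Recognizable.isClopen_base [DiscreteTopology (A 0)] (hrec : τ.Recognizable) (n : ℕ) (a : A n) :
    IsClopen (Subtype.val ⁻¹' τ.base n a : Set (τ.subshift 0)) := by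
  refine ⟨(τ.isCompact_base n a).isClosed.preimage continuous_subtype_val, ?_⟩
  set q : (a : A n) × Fin (τ.height n a) := ⟨a, ⟨0, τ.height_pos n a⟩⟩
  have : (Subtype.val ⁻¹' τ.base n a : Set (τ.subshift 0)) =
      (Subtype.val ⁻¹' ⋃ p ∈ ({q}ᶜ : Set ((a : A n) × Fin (τ.height n a))),
        τ.level n p.1 p.2)ᶜ := by
    ext x
    simp only [Set.mem_preimage, Set.mem_compl_iff, Set.mem_iUnion, not_exists]
    rw [base_eq_level]
    constructor
    · intro hx p hp hxp
      exact Set.disjoint_left.1 ((hrec n).1 hp) hxp hx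
    · intro hx
      obtain ⟨p, hp⟩ := Set.mem_iUnion.1 ((hrec n).2.ge x.2)
      by_cases hpq : p = q
      · rw [hpq] at hp; exact hp
      · exact absurd hp (hx p hpq)
  rw [this, isOpen_compl_iff]
  refine IsClosed.preimage continuous_subtype_val ?_
  exact (Set.toFinite _).isClosed_biUnion fun p _ => (τ.isCompact_level n p.1 p.2).isClosed

end Topology

end DirectiveSequence

/-! ### Orbit averages of measures and their weak limits -/

section Averages

open scoped ENNReal

variable {X : Type*} [MeasurableSpace X]

/-- The average of the images of `lam` under the first `h` iterates of `T`. -/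
noncomputable def orbitAverage (T : X → X) (lam : Measure X) (h : ℕ) : Measure X :=
  (h : ℝ≥0∞)⁻¹ • ∑ k ∈ Finset.range h, lam.map T^[k]

theorem isProbabilityMeasure_orbitAverage {T : X → X} (hT : Measurable T) (lam : Measure X)
    [IsProbabilityMeasure lam] {h : ℕ} (hh : 0 < h) :
    IsProbabilityMeasure (orbitAverage T lam h) := by
  constructor
  have : ∀ k ∈ Finset.range h, (lam.map T^[k]) Set.univ = 1 := by
    intro k _
    rw [Measure.map_apply (hT.iterate k) MeasurableSet.univ, Set.preimage_univ, measure_univ]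
  rw [orbitAverage, Measure.smul_apply, Measure.finsetSum_apply, Finset.sum_congr rfl this]
  simp only [Finset.sum_const, Finset.card_range, nsmul_eq_mul, mul_one, smul_eq_mul]
  exact ENNReal.inv_mul_cancel (by exact_mod_cast hh.ne') (ENNReal.natCast_ne_top h)

variable [TopologicalSpace X] [BorelSpace X]

theorem integral_orbitAverage {T : X → X} (hT : Continuous T) (lam : Measure X)
    [IsProbabilityMeasure lam] (h : ℕ) (f : BoundedContinuousFunction X ℝ) :
    ∫ x, f x ∂(orbitAverage T lam h) =
      (h : ℝ)⁻¹ * ∑ k ∈ Finset.range h, ∫ x, f (T^[k] x) ∂lam := by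
  have hp : ∀ k, IsProbabilityMeasure (lam.map T^[k]) := fun k =>
    Measure.isProbabilityMeasure_map (hT.measurable.iterate k).aemeasurable
  rw [orbitAverage, integral_smul_measure, integral_finsetSum_measure fun k _ => f.integrable _]
  rw [ENNReal.toReal_inv, ENNReal.toReal_natCast, smul_eq_mul]
  congr 1
  refine Finset.sum_congr rfl fun k _ => ?_
  exact integral_map (hT.measurable.iterate k).aemeasurable
    f.continuous.aestronglyMeasurable

theorem integral_orbitAverage_eq_of_ae {T : X → X} (hT : Continuous T) (lam : Measure X)
    [IsProbabilityMeasure lam] (h : ℕ) (f : BoundedContinuousFunction X ℝ) {c : ℝ}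
    (hc : ∀ᵐ x ∂lam, ∑ k ∈ Finset.range h, f (T^[k] x) = c) :
    ∫ x, f x ∂(orbitAverage T lam h) = c / h := by
  rw [integral_orbitAverage hT, ← integral_finsetSum, integral_congr_ae hc]
  · simp [div_eq_inv_mul]
  · intro k _
    exact (f.compContinuous ⟨_, hT.iterate k⟩).integrable _

/-- The difference telescopes, leaving two boundary terms of size at most `‖f‖`. -/
theorem abs_integral_orbitAverage_comp_sub_le {T : X → X} (hT : Continuous T) (lam : Measure X)
    [IsProbabilityMeasure lam] (h : ℕ) (f : BoundedContinuousFunction X ℝ) :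
    |∫ x, f (T x) ∂(orbitAverage T lam h) - ∫ x, f x ∂(orbitAverage T lam h)| ≤
      2 * ‖f‖ * (h : ℝ)⁻¹ := by
  have hb : ∀ k, |∫ x, f (T^[k] x) ∂lam| ≤ ‖f‖ := by
    intro k
    have := norm_integral_le_of_norm_le_const (μ := lam) (f := fun x => f (T^[k] x)) (C := ‖f‖)
      (.of_forall fun x => f.norm_coe_le_norm _)
    simpa using this
  have h1 := integral_orbitAverage hT lam h (f.compContinuous ⟨T, hT⟩)
  simp only [BoundedContinuousFunction.compContinuous_apply, ContinuousMap.coe_mk,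
    ← Function.iterate_succ_apply'] at h1
  rw [h1, integral_orbitAverage hT lam h f, ← mul_sub, ← Finset.sum_sub_distrib,
    Finset.sum_range_sub (fun k => ∫ x, f (T^[k] x) ∂lam), abs_mul, abs_of_nonneg (by positivity),
    mul_comm]
  gcongr
  have := abs_sub (∫ x, f (T^[h] x) ∂lam) (∫ x, f (T^[0] x) ∂lam)
  linarith [hb h, hb 0]

variable [TopologicalSpace.MetrizableSpace X]

/-- The Krylov–Bogolyubov argument, with starting measures that may vary with the index. -/
theorem measurePreserving_of_tendsto_orbitAverage {T : X → X} (hT : Continuous T)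
    {ι : Type*} {F : Filter ι} [F.NeBot] {lam : ι → ProbabilityMeasure X} {h : ι → ℕ}
    (hh : Tendsto h F atTop) {ν : ι → ProbabilityMeasure X}
    (hν : ∀ m, (ν m : Measure X) = orbitAverage T (lam m) (h m)) {ρ : ProbabilityMeasure X}
    (hρ : Tendsto ν F (𝓝 ρ)) : MeasurePreserving T (ρ : Measure X) ρ := by
  refine ⟨hT.measurable, ?_⟩
  have : IsProbabilityMeasure ((ρ : Measure X).map T) :=
    Measure.isProbabilityMeasure_map hT.measurable.aemeasurable
  refine ext_of_forall_integral_eq_of_IsFiniteMeasure fun f => ?_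
  rw [integral_map hT.measurable.aemeasurable f.continuous.aestronglyMeasurable]
  rw [ProbabilityMeasure.tendsto_iff_forall_integral_tendsto] at hρ
  have h1 := (hρ (f.compContinuous ⟨T, hT⟩)).sub (hρ f)
  have h2 : Tendsto (fun m => 2 * ‖f‖ * (h m : ℝ)⁻¹) F (𝓝 0) := by
    have := (tendsto_inv_atTop_zero.comp (tendsto_natCast_atTop_atTop.comp hh)).const_mul
      (2 * ‖f‖)
    rw [mul_zero] at this
    exact this
  have h3 : Tendsto (fun m => ∫ x, f (T x) ∂(ν m : Measure X) - ∫ x, f x ∂(ν m : Measure X)) F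
      (𝓝 0) := by
    refine squeeze_zero_norm (fun m => ?_) h2
    rw [hν m]
    exact abs_integral_orbitAverage_comp_sub_le hT (lam m : Measure X) (h m) f
  exact sub_eq_zero.1 (tendsto_nhds_unique h1 h3)

/-- The domination passes to the limit on open sets by the portmanteau theorem; outer regularity of
`μ` then handles null sets. -/
theorem absolutelyContinuous_of_tendsto {ι : Type*} {F : Filter ι} [F.NeBot]
    {ν : ι → ProbabilityMeasure X} {ρ : ProbabilityMeasure X} (hρ : Tendsto ν F (𝓝 ρ))
    (μ : Measure X) [IsFiniteMeasure μ] {C : ℝ≥0∞} (hC : C ≠ ∞)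
    (hν : ∀ᶠ m in F, (ν m : Measure X) ≤ C • μ) : (ρ : Measure X) ≪ μ := by
  have hopen : ∀ G, IsOpen G → (ρ : Measure X) G ≤ C * μ G := by
    intro G hG
    refine (ProbabilityMeasure.le_liminf_measure_open_of_tendsto hρ hG).trans ?_
    refine (liminf_le_liminf (hν.mono fun m hm => hm G)).trans ?_
    rw [liminf_const, Measure.smul_apply, smul_eq_mul]
  intro s hs
  refine le_antisymm (ENNReal.le_of_forall_pos_le_add fun ε hε _ => ?_) bot_le
  obtain ⟨δ, hδ, hδε⟩ := ENNReal.exists_pos_mul_lt hC (ENNReal.coe_pos.2 hε).ne'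
  obtain ⟨G, hsG, hG, hμG⟩ := s.exists_isOpen_lt_of_lt δ (hs.trans_lt hδ : μ s < δ)
  calc (ρ : Measure X) s ≤ C * μ G := (measure_mono hsG).trans (hopen G hG)
    _ ≤ C * δ := by gcongr
    _ ≤ 0 + ε := by rw [zero_add, mul_comm]; exact hδε.le

/-- Probability measures on a compact metrizable space form a compact space, so `ν` converges along
every ultrafilter, and identifying these limits is enough. -/
theorem tendsto_orbitAverage [CompactSpace X] {T : X → X} (hT : Continuous T)
    {lam : ℕ → ProbabilityMeasure X} {h : ℕ → ℕ} (hh : Tendsto h atTop atTop)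
    {ν : ℕ → ProbabilityMeasure X}
    (hν : ∀ m, (ν m : Measure X) = orbitAverage T (lam m) (h m)) {μ : ProbabilityMeasure X}
    (huniq : ∀ (ρ : ProbabilityMeasure X) (U : Ultrafilter ℕ), ↑U ≤ (atTop : Filter ℕ) →
      Tendsto ν U (𝓝 ρ) → MeasurePreserving T (ρ : Measure X) ρ → ρ = μ) :
    Tendsto ν atTop (𝓝 μ) := by
  rw [tendsto_iff_ultrafilter]
  intro U hU
  obtain ⟨ρ, -, hρ⟩ := isCompact_univ.ultrafilter_le_nhds (U.map ν) (by simp)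
  have hρ' : Tendsto ν U (𝓝 ρ) := hρ
  rwa [huniq ρ U hU hρ' (measurePreserving_of_tendsto_orbitAverage hT (hh.mono_left hU) hν hρ')]
    at hρ'

theorem tendsto_div_of_ae_sum_eq [CompactSpace X] {T : X → X} (hT : Continuous T)
    {lam : ℕ → ProbabilityMeasure X} {h : ℕ → ℕ} (hpos : ∀ m, 0 < h m)
    (hh : Tendsto h atTop atTop) {μ : ProbabilityMeasure X}
    (huniq : ∀ (ρ : ProbabilityMeasure X) (U : Ultrafilter ℕ), ↑U ≤ (atTop : Filter ℕ) →
      (∀ ν : ℕ → ProbabilityMeasure X,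
        (∀ m, (ν m : Measure X) = orbitAverage T (lam m) (h m)) → Tendsto ν U (𝓝 ρ)) →
      MeasurePreserving T (ρ : Measure X) ρ → ρ = μ)
    (f : BoundedContinuousFunction X ℝ) {c : ℕ → ℝ}
    (hc : ∀ᶠ m in atTop, ∀ᵐ x ∂(lam m : Measure X),
      ∑ k ∈ Finset.range (h m), f (T^[k] x) = c m) :
    Tendsto (fun m => c m / h m) atTop (𝓝 (∫ x, f x ∂(μ : Measure X))) := by
  set ν : ℕ → ProbabilityMeasure X := fun m => ⟨orbitAverage T (lam m) (h m),
    isProbabilityMeasure_orbitAverage hT.measurable _ (hpos m)⟩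
  have hν : Tendsto ν atTop (𝓝 μ) := by
    refine tendsto_orbitAverage hT hh (fun m => rfl) fun ρ U hU hρ => ?_
    refine huniq ρ U hU fun ν' hν' => ?_
    have : ν' = ν := funext fun m => Subtype.ext (hν' m)
    rwa [this]
  refine (ProbabilityMeasure.tendsto_iff_forall_integral_tendsto.1 hν f).congr' ?_
  filter_upwards [hc] with m hm
  exact integral_orbitAverage_eq_of_ae hT (lam m : Measure X) (h m) f hm

end Averages

/-! ### Conditioning an invariant measure on the base of a tower -/

section Averages

open scoped ENNReal

section Tower

variable {X : Type*} [MeasurableSpace X] {T : Equiv.Perm X} {μ : Measure X} {B : Set X} {h : ℕ}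

theorem measure_iterate_image (hT : MeasurePreserving T μ μ)
    (hmeas : ∀ k, MeasurableSet (T^[k] '' B)) (k : ℕ) : μ (T^[k] '' B) = μ B := by
  rw [← (hT.iterate k).measure_preimage (hmeas k).nullMeasurableSet,
    Set.preimage_image_eq B (T.injective.iterate k)]

theorem measure_inter_iUnion_iterate_image (hmeas : ∀ k, MeasurableSet (T^[k] '' B))
    (hdisj : Set.PairwiseDisjoint (Set.Iio h) fun k => T^[k] '' B) {E : Set X}
    (hE : MeasurableSet E) :
    μ (E ∩ ⋃ k ∈ Set.Iio h, T^[k] '' B) = ∑ k ∈ Finset.range h, μ (E ∩ T^[k] '' B) := by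
  rw [← Finset.coe_range h] at hdisj ⊢
  simp only [Finset.mem_coe]
  rw [Set.inter_iUnion₂, measure_biUnion_finset]
  · exact fun i hi j hj hij => (hdisj hi hj hij).mono Set.inter_subset_right Set.inter_subset_right
  · exact fun k _ => hE.inter (hmeas k)

theorem measure_iUnion_iterate_image (hT : MeasurePreserving T μ μ)
    (hmeas : ∀ k, MeasurableSet (T^[k] '' B))
    (hdisj : Set.PairwiseDisjoint (Set.Iio h) fun k => T^[k] '' B) :
    μ (⋃ k ∈ Set.Iio h, T^[k] '' B) = h * μ B := by
  have := measure_inter_iUnion_iterate_image (μ := μ) hmeas hdisj MeasurableSet.univ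
  simpa only [Set.univ_inter, measure_iterate_image hT hmeas, Finset.sum_const, Finset.card_range,
    nsmul_eq_mul] using this

/-- All levels have the same measure, so spreading `μ(· | B)` evenly over them gives `μ` conditioned
on the whole tower. The bound also holds when `μ B = 0`. -/
theorem orbitAverage_cond_le [IsFiniteMeasure μ] (hT : MeasurePreserving T μ μ)
    (hmeas : ∀ k, MeasurableSet (T^[k] '' B))
    (hdisj : Set.PairwiseDisjoint (Set.Iio h) fun k => T^[k] '' B) :
    orbitAverage T (ProbabilityTheory.cond μ B) h ≤ (μ (⋃ k ∈ Set.Iio h, T^[k] '' B))⁻¹ • μ := by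
  have hB : MeasurableSet B := by simpa using hmeas 0
  rw [Measure.le_iff]
  intro E hE
  have hmap : ∀ k ∈ Finset.range h, ((ProbabilityTheory.cond μ B).map T^[k]) E =
      (μ B)⁻¹ * μ (E ∩ T^[k] '' B) := by
    intro k _
    rw [Measure.map_apply (hT.iterate k).measurable hE, ProbabilityTheory.cond_apply hB,
      ← (hT.iterate k).measure_preimage (hE.inter (hmeas k)).nullMeasurableSet, Set.preimage_inter,
      Set.preimage_image_eq B (T.injective.iterate k), Set.inter_comm]
  rw [orbitAverage, Measure.smul_apply, Measure.finsetSum_apply, Finset.sum_congr rfl hmap,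
    ← Finset.mul_sum, ← measure_inter_iUnion_iterate_image hmeas hdisj hE,
    measure_iUnion_iterate_image hT hmeas hdisj, Measure.smul_apply, smul_eq_mul, smul_eq_mul, ← mul_assoc,
    ENNReal.mul_inv (.inr (measure_ne_top μ B)) (.inl (ENNReal.natCast_ne_top h))]
  gcongr
  exact Set.inter_subset_left

end Tower

end Averages

/-! ### Birkhoff sums over segments containing a generic point -/

section Generic

/-- The constant `C` absorbs the finitely many small `N`. A bound for all `N` is needed because one
side of the split segment may stay short. -/
theorem exists_abs_sub_le_of_tendsto_div {F : ℕ → ℝ} {c : ℝ}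
    (hF : Tendsto (fun N => F N / (N : ℝ)) atTop (𝓝 c)) {ε : ℝ} (hε : 0 < ε) :
    ∃ C, ∀ N : ℕ, |F N - c * N| ≤ ε * N + C := by
  obtain ⟨N₀, hN₀⟩ := Metric.tendsto_atTop.1 hF ε hε
  refine ⟨∑ i ∈ Finset.range (N₀ + 1), |F i - c * i|, fun N => ?_⟩
  have hC : 0 ≤ ∑ i ∈ Finset.range (N₀ + 1), |F i - c * i| :=
    Finset.sum_nonneg fun i _ => abs_nonneg _
  by_cases hN : N ≤ N₀
  · have := Finset.single_le_sum (f := fun i : ℕ => |F i - c * i|) (fun i _ => abs_nonneg _)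
      (Finset.mem_range.2 (Nat.lt_succ_of_le hN))
    have h2 : 0 ≤ ε * N := by positivity
    linarith
  · have hpos : (0 : ℝ) < N := by exact_mod_cast (by omega : 0 < N)
    have h1 := hN₀ N (by omega)
    rw [Real.dist_eq] at h1
    have h2 : F N - c * N = (F N / N - c) * N := by field_simp
    rw [h2, abs_mul, abs_of_pos hpos]
    nlinarith

theorem tendsto_add_div_of_tendsto_div {F G : ℕ → ℝ} {c d : ℝ}
    (hF : Tendsto (fun N => F N / (N : ℝ)) atTop (𝓝 c))
    (hG : Tendsto (fun N => G N / (N : ℝ)) atTop (𝓝 c)) {h k : ℕ → ℕ}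
    (hh : Tendsto h atTop atTop) (hk : ∀ m, k m ≤ h m) :
    Tendsto (fun m => (G (k m + 1) - d + F (h m - k m)) / (h m : ℝ)) atTop (𝓝 c) := by
  rw [Metric.tendsto_atTop']
  intro ε hε
  obtain ⟨C, hC⟩ := exists_abs_sub_le_of_tendsto_div hF (half_pos hε)
  obtain ⟨D, hD⟩ := exists_abs_sub_le_of_tendsto_div hG (half_pos hε)
  -- The linear errors of the two pieces add up to `ε / 2 * (h m + 1)`; `L` is chosen so that the
  -- remaining constants stay below `ε / 2 * h m`.
  obtain ⟨L, hL⟩ := exists_nat_gt ((ε / 2 + C + D + |c| + |d|) / (ε / 2))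
  obtain ⟨M, hM⟩ := eventually_atTop.1 (hh.eventually_ge_atTop (L + 1))
  refine ⟨M, fun m hm => ?_⟩
  have hLm : (L : ℝ) + 1 ≤ h m := by exact_mod_cast hM m hm.le
  have hL0 : (0 : ℝ) ≤ L := Nat.cast_nonneg L
  have hpos : (0 : ℝ) < h m := by linarith
  rw [div_lt_iff₀ (half_pos hε)] at hL
  have h1 := hC (h m - k m)
  have h2 := hD (k m + 1)
  rw [Nat.cast_sub (hk m)] at h1
  push_cast at h2
  rw [Real.dist_eq]
  have h3 : (G (k m + 1) - d + F (h m - k m)) / (h m : ℝ) - c =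
      (G (k m + 1) - d + F (h m - k m) - c * h m) / h m := by field_simp
  rw [h3, abs_div, abs_of_pos hpos, div_lt_iff₀ hpos]
  have h4 : G (k m + 1) - d + F (h m - k m) - c * h m =
      (G (k m + 1) - c * (k m + 1)) + (F (h m - k m) - c * (h m - k m)) + (c - d) := by ring
  have h5 := abs_add_le ((G (k m + 1) - c * (k m + 1)) + (F (h m - k m) - c * (h m - k m))) (c - d)
  have h6 := abs_add_le (G (k m + 1) - c * (k m + 1)) (F (h m - k m) - c * (h m - k m))
  have h7 := abs_sub c d
  rw [h4]
  nlinarith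

/-- The point `(T ^ k) x` starts both the backward and the forward sum, so one copy of its value is
subtracted. -/
theorem sum_range_eq_backward_add_forward {X : Type*} (T : Equiv.Perm X) (f : X → ℝ) (x : X)
    {k h : ℕ} (hk : k ≤ h) :
    ∑ i ∈ Finset.range h, f ((T ^ i) x) =
      (∑ i ∈ Finset.range (k + 1), f ((T⁻¹ ^ i) ((T ^ k) x)) - f ((T ^ k) x)) +
        ∑ i ∈ Finset.range (h - k), f ((T ^ i) ((T ^ k) x)) := by
  obtain ⟨l, rfl⟩ := Nat.exists_eq_add_of_le hk
  rw [Finset.sum_range_add, Nat.add_sub_cancel_left, Finset.sum_range_succ']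
  have h1 : ∑ i ∈ Finset.range l, f ((T ^ (k + i)) x) =
      ∑ i ∈ Finset.range l, f ((T ^ i) ((T ^ k) x)) :=
    Finset.sum_congr rfl fun i _ => by rw [← Equiv.Perm.mul_apply, ← pow_add, add_comm]
  have h2 : ∑ i ∈ Finset.range k, f ((T ^ i) x) =
      ∑ i ∈ Finset.range k, f ((T⁻¹ ^ (i + 1)) ((T ^ k) x)) := by
    rw [← Finset.sum_range_reflect]
    refine Finset.sum_congr rfl fun i hi => ?_
    have hi' := Finset.mem_range.1 hi
    have e : T ^ k = T ^ (i + 1) * T ^ (k - 1 - i) := by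
      rw [← pow_add]; congr 1; omega
    rw [e, Equiv.Perm.mul_apply, inv_pow]
    simp
  rw [h1, h2]
  simp

end Generic

/-! ### Letter frequencies under each condition -/

namespace DirectiveSequence

variable {A : ℕ → Type*} {τ : DirectiveSequence A}

theorem continuous_S [TopologicalSpace (A 0)] : Continuous τ.S :=
  (continuous_shift.comp continuous_subtype_val).subtype_mk _

section Towers

variable [Nonempty (A 0)]

theorem Recognizable.iterate_S_image_base (hrec : τ.Recognizable) (n : ℕ) (a : A n) (k : ℕ) :
    τ.S^[k] '' (Subtype.val ⁻¹' τ.base n a) =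
      (Subtype.val ⁻¹' τ.level n a k : Set (τ.subshift 0)) := by
  rw [Equiv.Perm.iterate_eq_pow]
  ext x
  constructor
  · rintro ⟨x', hx', rfl⟩
    exact ⟨x', hx', (τ.S_pow_coe k x').symm⟩
  · rintro ⟨x', hx', h⟩
    refine ⟨⟨x', hrec.base_subset n a hx'⟩, hx', Subtype.ext ?_⟩
    rw [τ.S_pow_coe]
    exact h

theorem Recognizable.iUnion_iterate_S_image_base (hrec : τ.Recognizable) (n : ℕ) (a : A n) :
    ⋃ k ∈ Set.Iio (τ.height n a), τ.S^[k] '' (Subtype.val ⁻¹' τ.base n a) =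
      (Subtype.val ⁻¹' τ.tower n a : Set (τ.subshift 0)) := by
  simp only [hrec.iterate_S_image_base, tower, Set.preimage_iUnion]

theorem Recognizable.pairwiseDisjoint_iterate_S_image_base (hrec : τ.Recognizable) (n : ℕ)
    (a : A n) : Set.PairwiseDisjoint (Set.Iio (τ.height n a))
      fun k => τ.S^[k] '' (Subtype.val ⁻¹' τ.base n a) := by
  intro i hi j hj hij
  change Disjoint (τ.S^[i] '' _) (τ.S^[j] '' _)
  rw [hrec.iterate_S_image_base, hrec.iterate_S_image_base]
  refine Disjoint.preimage _ ((hrec n).1 (i := ⟨a, ⟨i, hi⟩⟩) (j := ⟨a, ⟨j, hj⟩⟩) fun h => hij ?_)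
  exact congrArg Fin.val (eq_of_heq (Sigma.mk.inj_iff.1 h).2)

variable [∀ n, Finite (A n)] [TopologicalSpace (A 0)] [DiscreteTopology (A 0)]

instance : CompactSpace (τ.subshift 0) :=
  isCompact_iff_compactSpace.1 (τ.isClosed_subshift 0).isCompact

/-- The indicator function of `B_n(a)`, which is continuous as `B_n(a)` is clopen. -/
noncomputable def baseIndicator (hrec : τ.Recognizable) (n : ℕ) (a : A n) : C(τ.subshift 0, ℝ) :=
  LocallyConstant.toContinuousMap (LocallyConstant.charFn ℝ (hrec.isClopen_base n a))

theorem baseIndicator_apply (hrec : τ.Recognizable) (n : ℕ) (a : A n) (x : τ.subshift 0) :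
    baseIndicator hrec n a x = (τ.base n a).indicator (1 : (ℤ → A 0) → ℝ) x := rfl

theorem sum_baseIndicator [∀ n, DecidableEq (A n)] (hrec : τ.Recognizable) {n m : ℕ} (h : n ≤ m) (a : A n) (b : A m)
    {x : τ.subshift 0} (hx : (x : ℤ → A 0) ∈ τ.base m b) :
    ∑ k ∈ Finset.range (τ.height m b), baseIndicator hrec n a ((τ.S ^ k) x) =
      letterCount a (τ.image h b) := by
  rw [← hrec.sum_indicator_base h a b hx]
  exact Finset.sum_congr rfl fun k _ => by rw [baseIndicator_apply, S_pow_coe]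

variable [MeasurableSpace (A 0)] [BorelSpace (A 0)]

theorem integral_baseIndicator (hrec : τ.Recognizable) (n : ℕ) (a : A n)
    (μ : Measure (τ.subshift 0)) :
    ∫ x, baseIndicator hrec n a x ∂μ = μ.real (Subtype.val ⁻¹' τ.base n a) :=
  integral_indicator_one (hrec.isClopen_base n a).isOpen.measurableSet

theorem Recognizable.measurableSet_iterate_S_image_base (hrec : τ.Recognizable) (n : ℕ) (a : A n)
    (k : ℕ) : MeasurableSet (τ.S^[k] '' (Subtype.val ⁻¹' τ.base n a)) := by
  rw [hrec.iterate_S_image_base]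
  exact measurable_subtype_coe (τ.isCompact_level n a k).isClosed.measurableSet

variable [∀ n, DecidableEq (A n)]

theorem tendsto_of_isGeneric (hprim : τ.Primitive) (hrec : τ.Recognizable)
    {μ : Measure (τ.subshift 0)} (b : ∀ m, A m) {x : τ.subshift 0} (hx : IsGeneric τ.S μ x)
    (hxb : ∀ m, (x : ℤ → A 0) ∈ τ.tower m (b m)) (n : ℕ) (a : A n) :
    Tendsto (fun k : ℕ => (letterCount a (τ.image (Nat.le_add_right n k) (b (n + k))) : ℝ) /
      (τ.height (n + k) (b (n + k)) : ℝ)) atTop (𝓝 (μ.real (Subtype.val ⁻¹' τ.base n a))) := by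
  -- Here `j` is the floor of the tower on which `x` lies, and `x'` is the point of the base below
  -- it.
  have key : ∀ k, ∃ j ≤ τ.height (n + k) (b (n + k)), ∃ x' : τ.subshift 0,
      (x' : ℤ → A 0) ∈ τ.base (n + k) (b (n + k)) ∧ (τ.S ^ j) x' = x := by
    intro k
    obtain ⟨j, hj, x', hx', h⟩ := Set.mem_iUnion₂.1 (hxb (n + k))
    refine ⟨j, le_of_lt hj, ⟨x', hrec.base_subset _ _ hx'⟩, hx', Subtype.ext ?_⟩
    rw [τ.S_pow_coe]
    exact h
  choose j hj x' hx' hjx using key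
  set f := baseIndicator hrec n a
  have hh := (τ.tendsto_height hprim ⟨x, x.2⟩ b).comp
    (tendsto_atTop_mono (fun k => Nat.le_add_left k n) tendsto_id)
  have h1 := tendsto_add_div_of_tendsto_div (d := f x) (hx f).1 (hx f).2 hh hj
  rw [integral_baseIndicator] at h1
  refine h1.congr fun k => ?_
  rw [← sum_baseIndicator hrec (Nat.le_add_right n k) a _ (hx' k),
    sum_range_eq_backward_add_forward τ.S _ _ (hj k), hjx]
  rfl

/-- Letter frequencies from probability measures on the bases `B_m(b_m)`, if every invariant
limit of their averages along the towers is `μ`. -/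
theorem tendsto_of_orbitAverage (hprim : τ.Primitive) (hrec : τ.Recognizable)
    (μ : ProbabilityMeasure (τ.subshift 0)) (b : ∀ m, A m) (n : ℕ) (a : A n)
    (lam : ℕ → ProbabilityMeasure (τ.subshift 0))
    (hlam : ∀ᶠ k in atTop, ∀ᵐ x : τ.subshift 0 ∂(lam k : Measure (τ.subshift 0)),
      (x : ℤ → A 0) ∈ τ.base (n + k) (b (n + k)))
    (huniq : ∀ (ρ : ProbabilityMeasure (τ.subshift 0)) (U : Ultrafilter ℕ),
      ↑U ≤ (atTop : Filter ℕ) → (∀ ν : ℕ → ProbabilityMeasure (τ.subshift 0),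
        (∀ k, (ν k : Measure (τ.subshift 0)) =
          orbitAverage τ.S (lam k) (τ.height (n + k) (b (n + k)))) → Tendsto ν U (𝓝 ρ)) →
      MeasurePreserving τ.S (ρ : Measure (τ.subshift 0)) ρ → ρ = μ) :
    Tendsto (fun k : ℕ => (letterCount a (τ.image (Nat.le_add_right n k) (b (n + k))) : ℝ) /
      (τ.height (n + k) (b (n + k)) : ℝ)) atTop
      (𝓝 ((μ : Measure (τ.subshift 0)).real (Subtype.val ⁻¹' τ.base n a))) := by
  obtain ⟨x⟩ : Nonempty (τ.subshift 0) := μ.nonempty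
  rw [← integral_baseIndicator hrec]
  refine tendsto_div_of_ae_sum_eq continuous_S (h := fun k => τ.height (n + k) (b (n + k)))
    (fun k => τ.height_pos _ _) ((τ.tendsto_height hprim ⟨x, x.2⟩ b).comp
      (tendsto_atTop_mono (fun k => Nat.le_add_left k n) tendsto_id)) huniq
    (BoundedContinuousFunction.mkOfCompact (baseIndicator hrec n a)) ?_
  filter_upwards [hlam] with k hk
  filter_upwards [hk] with x hx
  simp only [BoundedContinuousFunction.mkOfCompact_apply, Equiv.Perm.iterate_eq_pow]
  exact sum_baseIndicator hrec (Nat.le_add_right n k) a _ hx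

theorem tendsto_of_uniquelyErgodic (hprim : τ.Primitive) (hrec : τ.Recognizable)
    {μ : Measure (τ.subshift 0)} [IsProbabilityMeasure μ] (hμ : MeasurePreserving τ.S μ μ)
    (huniq : UniquelyErgodic τ.S) (b : ∀ m, A m) (n : ℕ) (a : A n) :
    Tendsto (fun k : ℕ => (letterCount a (τ.image (Nat.le_add_right n k) (b (n + k))) : ℝ) /
      (τ.height (n + k) (b (n + k)) : ℝ)) atTop (𝓝 (μ.real (Subtype.val ⁻¹' τ.base n a))) := by
  obtain ⟨x⟩ : Nonempty (τ.subshift 0) := nonempty_of_isProbabilityMeasure μ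
  choose y hy using fun k => hrec.base_nonempty hprim ⟨x, x.2⟩ (n + k) (b (n + k))
  refine tendsto_of_orbitAverage hprim hrec ⟨μ, inferInstance⟩ b n a
    (fun k => ⟨Measure.dirac ⟨y k, hrec.base_subset _ _ (hy k)⟩, inferInstance⟩)
    (.of_forall fun k => ?_) fun ρ _ _ _ hρ => ?_
  · refine (ae_dirac_iff ?_).2 (hy k)
    exact measurable_subtype_coe (τ.isCompact_base _ _).isClosed.measurableSet
  · exact Subtype.ext (huniq.unique ⟨ρ.2, hρ⟩ ⟨inferInstance, hμ⟩)

theorem tendsto_of_le_measure_tower (hprim : τ.Primitive) (hrec : τ.Recognizable)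
    {μ : Measure (τ.subshift 0)} [IsProbabilityMeasure μ] (hμ : Ergodic τ.S μ)
    (b : ∀ m, A m) {δ : ENNReal} (hδ : δ ≠ 0)
    (hb : ∀ᶠ m in atTop, δ ≤ μ (Subtype.val ⁻¹' τ.tower m (b m))) (n : ℕ) (a : A n) :
    Tendsto (fun k : ℕ => (letterCount a (τ.image (Nat.le_add_right n k) (b (n + k))) : ℝ) /
      (τ.height (n + k) (b (n + k)) : ℝ)) atTop (𝓝 (μ.real (Subtype.val ⁻¹' τ.base n a))) := by
  classical
  set B : ℕ → Set (τ.subshift 0) := fun k => Subtype.val ⁻¹' τ.base (n + k) (b (n + k)) with hB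
  set lam : ℕ → ProbabilityMeasure (τ.subshift 0) := fun k =>
    if h : μ (B k) = 0 then ⟨μ, inferInstance⟩
    else ⟨ProbabilityTheory.cond μ (B k), ProbabilityTheory.cond_isProbabilityMeasure h⟩ with hlam
  have hlam' : ∀ k, μ (B k) ≠ 0 →
      (lam k : Measure (τ.subshift 0)) = ProbabilityTheory.cond μ (B k) := by
    intro k hk
    simp [hlam, hk]
  have hb' : ∀ᶠ k in atTop, δ ≤ μ (Subtype.val ⁻¹' τ.tower (n + k) (b (n + k))) :=
    (tendsto_atTop_mono (fun k => Nat.le_add_left k n) tendsto_id).eventually hb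
  have hne : ∀ k, δ ≤ μ (Subtype.val ⁻¹' τ.tower (n + k) (b (n + k))) → μ (B k) ≠ 0 := by
    intro k hk h0
    rw [← hrec.iUnion_iterate_S_image_base, measure_iUnion_iterate_image hμ.toMeasurePreserving
      (hrec.measurableSet_iterate_S_image_base _ _)
      (hrec.pairwiseDisjoint_iterate_S_image_base _ _)] at hk
    change δ ≤ _ * μ (B k) at hk
    rw [h0, mul_zero] at hk
    exact hδ (le_antisymm hk bot_le)
  refine tendsto_of_orbitAverage hprim hrec ⟨μ, inferInstance⟩ b n a lam ?_
    fun ρ U hU hν hρ => ?_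
  · filter_upwards [hb'] with k hk
    rw [hlam' k (hne k hk)]
    exact ProbabilityTheory.ae_cond_mem
      (measurable_subtype_coe (τ.isCompact_base _ _).isClosed.measurableSet)
  · have := ρ.2
    -- Ergodicity makes `μ` the only invariant probability measure absolutely continuous with
    -- respect to `μ`.
    refine Subtype.ext (hμ.eq_of_absolutelyContinuous hρ ?_)
    refine absolutelyContinuous_of_tendsto (hν (fun k => ⟨orbitAverage τ.S (lam k)
      (τ.height (n + k) (b (n + k))), isProbabilityMeasure_orbitAverage continuous_S.measurable _
        (τ.height_pos _ _)⟩) fun k => rfl) μ (ENNReal.inv_ne_top.2 hδ) ?_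
    filter_upwards [hU hb'] with k hk
    change orbitAverage τ.S (lam k) _ ≤ _
    rw [hlam' k (hne k hk)]
    refine (orbitAverage_cond_le hμ.toMeasurePreserving
      (hrec.measurableSet_iterate_S_image_base _ _)
      (hrec.pairwiseDisjoint_iterate_S_image_base _ _)).trans ?_
    rw [hrec.iUnion_iterate_S_image_base]
    refine Measure.le_iff.2 fun E _ => ?_
    rw [Measure.smul_apply, Measure.smul_apply, smul_eq_mul, smul_eq_mul]
    gcongr

end Towers

end DirectiveSequence

end SAdic

theorem mainTheorem5 {A : ℕ → Type*} [∀ n, Finite (A n)] [∀ n, Nonempty (A n)]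
    [∀ n, DecidableEq (A n)]
    [TopologicalSpace (A 0)] [DiscreteTopology (A 0)] [MeasurableSpace (A 0)] [BorelSpace (A 0)]
    (τ : SAdic.DirectiveSequence A) (hprim : τ.Primitive) (hrec : τ.Recognizable)
    (μ : Measure (τ.subshift 0)) [IsProbabilityMeasure μ] (hμ : Ergodic τ.S μ)
    (b : ∀ m, A m)
    (h : (∃ x : τ.subshift 0, SAdic.IsGeneric τ.S μ x ∧ ∀ m, (x : ℤ → A 0) ∈ τ.tower m (b m)) ∨
      0 < liminf (fun m => μ (Subtype.val ⁻¹' τ.tower m (b m))) atTop ∨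
      (∃ A' : ∀ n, Set (A n), τ.Adapted A' μ ∧ ∀ m, b m ∈ A' m) ∨
      SAdic.UniquelyErgodic τ.S)
    (n : ℕ) (a : A n) :
    Tendsto (fun k : ℕ =>
        (SAdic.letterCount a (τ.image (Nat.le_add_right n k) (b (n + k))) : ℝ) /
          (τ.height (n + k) (b (n + k)) : ℝ))
      atTop (𝓝 (μ.real (Subtype.val ⁻¹' τ.base n a))) := by
  rcases h with ⟨x, hx, hxb⟩ | h | ⟨A', ⟨-, δ, hδ, hA'⟩, hb⟩ | h
  · exact SAdic.DirectiveSequence.tendsto_of_isGeneric hprim hrec b hx hxb n a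
  · obtain ⟨δ, hδ, hδ'⟩ := exists_between h
    exact SAdic.DirectiveSequence.tendsto_of_le_measure_tower hprim hrec hμ b hδ.ne'
      ((eventually_lt_of_lt_liminf hδ').mono fun m hm => hm.le) n a
  · refine SAdic.DirectiveSequence.tendsto_of_le_measure_tower hprim hrec hμ b
      (ENNReal.ofReal_pos.2 hδ).ne' (.of_forall fun m => ?_) n a
    exact ENNReal.ofReal_le_of_le_toReal (hA' m (b m) (hb m))
  · exact SAdic.DirectiveSequence.tendsto_of_uniquelyErgodic hprim hrec hμ.toMeasurePreserving h
      b n a
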